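/- A Steiner $t$-spanner for a finite point set $P \subset \mathbb{R}^d$ is a finite graph $H$ whose vertices are points of $\mathbb{R}^d$ and include all of $P$ (the other vertices are called Steiner points), whose edges are weighted by the Euclidean distance between their endpoints, and whose weighted shortest-path distance satisfies $d_H(x,y) \le t\,|xy|$ for all $x,y \in P$. Theorem. There is an absolute constant $C$ such that for every $0 < \epsilon \le 1/2$, every $n$ and every set $P$ of $n$ points in $\mathbb{R}^2$, there is a Steiner $(1+\epsilon)$-spanner for $P$ with at most $C \cdot \frac{n}{\sqrt{\epsilon}} \log^2\frac{1}{\epsilon}$ edges. More generally, for every $d \ge 2$ there is a constant $C_d$, depending only on $d$, such that for every $0 < \epsilon \le 1/2$, every $n$ and every set $P$ of $n$ points in $\mathbb{R}^d$, there is a Steiner $(1+\epsilon)$-spanner for $P$ with at most $C_d \cdot \frac{n}{\epsilon^{(d-1)/2}} \log^2\frac{1}{\epsilon}$ edges. -/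

import Mathlib

open scoped ENNReal

/-- A geometric graph in `ℝ^d`: a set of points of `ℝ^d` together with a set of straight-line edges
between distinct members of it, that is, a subgraph of the complete graph on the points of `ℝ^d`. -/
abbrev GeometricGraph (d : ℕ) : Type :=
  (⊤ : SimpleGraph (EuclideanSpace ℝ (Fin d))).Subgraph

/-- The weight of a walk in a graph on points of `ℝ^d`: the sum of the Euclidean lengths of the
edges it traverses, with multiplicity. -/
noncomputable def walkWeight {d : ℕ} {G : SimpleGraph (EuclideanSpace ℝ (Fin d))}
    {x y : EuclideanSpace ℝ (Fin d)} (w : G.Walk x y) : ℝ≥0∞ :=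
  (w.darts.map fun e => edist e.fst e.snd).sum

/-- The weighted graph distance `d_H(x, y)`: the infimum of the weights of the walks of `H` from
`x` to `y`; it is `∞` if `x` and `y` are not connected in `H`. -/
noncomputable def geomDist {d : ℕ} (H : GeometricGraph d) (x y : EuclideanSpace ℝ (Fin d)) :
    ℝ≥0∞ :=
  ⨅ w : H.spanningCoe.Walk x y, walkWeight w

/-- `H` is a Steiner `t`-spanner for the finite point set `P`: a finite geometric graph whose vertex
set contains `P` (its other vertices are the Steiner points) and which preserves all the distances
between points of `P` up to the factor `t`. -/
structure IsSteinerSpanner {d : ℕ} (t : ℝ) (P : Finset (EuclideanSpace ℝ (Fin d)))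
    (H : GeometricGraph d) : Prop where
  finite_verts : H.verts.Finite
  subset_verts : (P : Set (EuclideanSpace ℝ (Fin d))) ⊆ H.verts
  geomDist_le : ∀ x ∈ P, ∀ y ∈ P, geomDist H x y ≤ ENNReal.ofReal t * edist x y

/-! A pair `x`, `y` at distance about `ρ` is replaced by net points `p`, `q` within `ερ/20`, which
are joined through one Steiner point near the middle half of the segment `pq`. By Pythagoras, a
sideways deviation of order `√ε ρ` costs only order `ερ`. So the grid must be `√ε ρ`-fine only in
the `d - 1` directions other than a dominant coordinate, and `p` is joined to `O(ε^(-(d-1)/2))` grid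
points (`exists_common_steinerPoint`, `card_steinerPoints_le`). The gaps `xp` and `qy` are shorter
than `xy`, so induction on distance bridges them.

The number of scales is unbounded in terms of `n` and `ε`, but only `O(n log (1/ε))` pairs (net
point, scale) have a partner at the right distance (`exists_active_pairs_bound`). This yields a
single logarithm; the second one is slack. -/

/-! ### Nested nets and charging over scales. -/

section Nets

variable {α : Type*} [MetricSpace α]

/-- A separated subset of a finite set extends to a net at the same scale. -/
theorem exists_separated_cover_superset (P S : Finset α) {r : ℝ} (hr : 0 ≤ r) (hSP : S ⊆ P)
    (hS : (S : Set α).Pairwise fun x y => r < dist x y) :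
    ∃ T : Finset α, S ⊆ T ∧ T ⊆ P ∧ ((T : Set α).Pairwise fun x y => r < dist x y) ∧
      ∀ x ∈ P, ∃ p ∈ T, dist x p ≤ r := by
  classical
  let F : Finset (Finset α) :=
    P.powerset.filter fun T => S ⊆ T ∧ (T : Set α).Pairwise fun x y => r < dist x y
  have hF : ∀ T, T ∈ F ↔ T ⊆ P ∧ S ⊆ T ∧ (T : Set α).Pairwise fun x y => r < dist x y := by
    intro T
    simp [F]
  obtain ⟨T, hT, hmax⟩ := F.exists_max_image Finset.card ⟨S, (hF S).2 ⟨hSP, subset_rfl, hS⟩⟩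
  obtain ⟨hTP, hST, hsep⟩ := (hF T).1 hT
  refine ⟨T, hST, hTP, hsep, fun x hx => ?_⟩
  by_contra! hfar
  have hxT : x ∉ T := fun h => by
    have := hfar x h
    rw [dist_self] at this
    linarith
  have hins : insert x T ∈ F := by
    refine (hF _).2 ⟨Finset.insert_subset hx hTP, hST.trans (Finset.subset_insert _ _), ?_⟩
    rw [Finset.coe_insert]
    refine hsep.insert fun y hy _ => ⟨hfar y hy, ?_⟩
    rw [dist_comm]
    exact hfar y hy
  have := hmax _ hins
  rw [Finset.card_insert_of_notMem hxT] at this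
  omega

/-- Every finite set has a nested sequence of nets at the scales `R / 2 ^ m`. -/
theorem exists_nested_nets (P : Finset α) {R : ℝ} (hR : 0 < R) :
    ∃ N : ℕ → Finset α, Monotone N ∧ (∀ m, N m ⊆ P) ∧
      (∀ m, (N m : Set α).Pairwise fun x y => R / 2 ^ m < dist x y) ∧
      ∀ m, ∀ x ∈ P, ∃ p ∈ N m, dist x p ≤ R / 2 ^ m := by
  have hpos : ∀ m : ℕ, 0 ≤ R / 2 ^ m := fun m => by positivity
  choose! f hf using fun (m : ℕ) (S : Finset α)
    (h : S ⊆ P ∧ (S : Set α).Pairwise fun x y => R / 2 ^ m < dist x y) =>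
    exists_separated_cover_superset P S (hpos m) h.1 h.2
  obtain ⟨N, hzero, hsucc⟩ : ∃ N : ℕ → Finset α, N 0 = f 0 ∅ ∧ ∀ m, N (m + 1) = f (m + 1) (N m) :=
    ⟨Nat.rec (f 0 ∅) fun m S => f (m + 1) S, rfl, fun _ => rfl⟩
  have h0 := hf 0 ∅ ⟨Finset.empty_subset _, by simp⟩
  have hscale : ∀ m : ℕ, R / 2 ^ (m + 1) ≤ R / 2 ^ m := fun m => by
    gcongr <;> norm_num
  have key : ∀ m, N m ⊆ P ∧ ((N m : Set α).Pairwise fun x y => R / 2 ^ m < dist x y) ∧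
      ∀ x ∈ P, ∃ p ∈ N m, dist x p ≤ R / 2 ^ m := by
    intro m
    induction m with
    | zero => rw [hzero]; exact h0.2
    | succ m ih =>
      rw [hsucc]
      exact (hf (m + 1) (N m) ⟨ih.1, ih.2.1.mono' fun x y hxy => (hscale m).trans_lt hxy⟩).2
  refine ⟨N, monotone_nat_of_le_succ fun m => ?_, fun m => (key m).1, fun m => (key m).2.1,
    fun m => (key m).2.2⟩
  rw [hsucc]
  exact (hf (m + 1) (N m) ⟨(key m).1, (key m).2.1.mono' fun x y hxy => (hscale m).trans_lt hxy⟩).1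

/-- In a nested sequence of nets, the net points `p` of level `m + 3 + k` that have a point of `P`
at distance about `R / 2 ^ (m + 3)`, over all `m`, number at most `k + 9` per point of `P`. -/
theorem exists_active_pairs_bound (P : Finset α) {R : ℝ} (hR : 0 < R) (N : ℕ → Finset α)
    (hmono : Monotone N) (hNP : ∀ m, N m ⊆ P)
    (hsep : ∀ m, (N m : Set α).Pairwise fun x y => R / 2 ^ m < dist x y)
    (hcov : ∀ m, ∀ x ∈ P, ∃ p ∈ N m, dist x p ≤ R / 2 ^ m) (k : ℕ) :
    ∃ A : Finset (α × ℕ), A.card ≤ P.card * (k + 9) ∧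
      ∀ m, ∀ p ∈ N (m + 3 + k), ∀ q ∈ P, R / 2 ^ (m + 3) / 4 ≤ dist p q →
        dist p q ≤ 2 * (R / 2 ^ (m + 3)) → (p, m) ∈ A := by
  classical
  -- The level at which `p` first becomes a net point; `L K` collects the `K` levels just below it.
  let lev : α → ℕ := fun p => sInf {m | p ∈ N m}
  let L : ℕ → Finset (α × ℕ) := fun K =>
    (P ×ˢ Finset.range K).image fun a => (a.1, lev a.1 - (a.2 + 1))
  have hLcard : ∀ K, (L K).card ≤ P.card * K := fun K =>
    Finset.card_image_le.trans (by simp)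
  have hL : ∀ m K p, p ∈ N (m + K) → p ∉ N m → (p, m) ∈ L K := by
    intro m K p hp hpm
    have h1 : lev p ≤ m + K := Nat.sInf_le hp
    have h2 : m < lev p := by
      by_contra! h
      exact hpm (hmono h (Nat.sInf_mem (s := {m | p ∈ N m}) ⟨_, hp⟩))
    refine Finset.mem_image.2 ⟨(p, lev p - m - 1), ?_, ?_⟩
    · simp only [Finset.mem_product, Finset.mem_range]
      exact ⟨hNP _ hp, by omega⟩
    · simp only [Prod.mk.injEq, true_and]
      omega
  -- The net point within half the separation is unique; the default value plays no role.
  let f : α × ℕ → α := fun a =>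
    if h : ∃ p ∈ N a.2, dist p a.1 < R / 2 ^ a.2 / 2 then h.choose else a.1
  have hf : ∀ q m p, p ∈ N m → dist p q < R / 2 ^ m / 2 → f (q, m) = p := by
    intro q m p hp hpq
    have h : ∃ p ∈ N m, dist p q < R / 2 ^ m / 2 := ⟨p, hp, hpq⟩
    have hfe : f (q, m) = h.choose := dif_pos h
    rw [hfe]
    by_contra hne
    have h1 := hsep m h.choose_spec.1 hp hne
    have h2 := dist_triangle_right h.choose p q
    linarith [h.choose_spec.2]
  -- If `p` is new since level `m`, it pays for itself. An older `p` is charged to a net point `q'`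
  -- near its partner: `q'` is too close to `p` to lie in `N m`, so it is new, and it determines `p`
  -- through `f`.
  refine ⟨L (3 + k) ∪ (L 6).image fun a => (f a, a.2), ?_, ?_⟩
  · calc _ ≤ (L (3 + k)).card + ((L 6).image fun a => (f a, a.2)).card := Finset.card_union_le _ _
      _ ≤ P.card * (3 + k) + P.card * 6 :=
        add_le_add (hLcard _) (Finset.card_image_le.trans (hLcard _))
      _ = P.card * (k + 9) := by ring
  · intro m p hp q hq h1 h2
    rw [Finset.mem_union]
    by_cases hpm : p ∈ N m
    · right
      obtain ⟨q', hq', hqq'⟩ := hcov (m + 6) q hq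
      have e3 : R / 2 ^ (m + 3) = R / 2 ^ m / 8 := by
        rw [pow_add, div_div]; norm_num
      have e6 : R / 2 ^ (m + 6) = R / 2 ^ m / 64 := by
        rw [pow_add, div_div]; norm_num
      have hpos : 0 < R / 2 ^ m := by positivity
      rw [e3] at h1 h2
      rw [e6] at hqq'
      have ht := dist_triangle p q q'
      have ht' := dist_triangle_right p q q'
      have hne : p ≠ q' := by
        rintro rfl
        rw [dist_comm] at hqq'
        linarith
      have hq'm : q' ∉ N m := fun h => by
        have := hsep m hpm h hne
        linarith
      refine Finset.mem_image.2 ⟨(q', m), hL _ _ _ hq' hq'm, ?_⟩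
      simp only [Prod.mk.injEq, and_true]
      exact hf _ _ _ hpm (by linarith)
    · left
      refine hL m (3 + k) p ?_ hpm
      rwa [← add_assoc]

end Nets

/-! ### Graph distance and graphs built from pairs. -/

section GraphOfPairs

variable {d : ℕ}

theorem walkWeight_append {G : SimpleGraph (EuclideanSpace ℝ (Fin d))}
    {x y z : EuclideanSpace ℝ (Fin d)} (v : G.Walk x y) (w : G.Walk y z) :
    walkWeight (v.append w) = walkWeight v + walkWeight w := by
  simp [walkWeight, SimpleGraph.Walk.darts_append]

theorem geomDist_triangle (H : GeometricGraph d) (x y z : EuclideanSpace ℝ (Fin d)) :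
    geomDist H x z ≤ geomDist H x y + geomDist H y z := by
  unfold geomDist
  rw [ENNReal.iInf_add]
  refine le_iInf fun v => ?_
  rw [ENNReal.add_iInf]
  exact le_iInf fun w => iInf_le_of_le (v.append w) (walkWeight_append v w).le

theorem geomDist_self (H : GeometricGraph d) (x : EuclideanSpace ℝ (Fin d)) :
    geomDist H x x = 0 :=
  le_antisymm (iInf_le_of_le SimpleGraph.Walk.nil (by simp [walkWeight])) zero_le

theorem geomDist_le_edist_of_adj (H : GeometricGraph d) {x y : EuclideanSpace ℝ (Fin d)}
    (h : H.Adj x y) : geomDist H x y ≤ edist x y :=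
  iInf_le_of_le (SimpleGraph.Walk.cons (H.spanningCoe_adj x y ▸ h) SimpleGraph.Walk.nil)
    (by simp [walkWeight])

/-- The geometric graph with the given points and the segments between the given pairs. -/
noncomputable def graphOfPairs (P : Finset (EuclideanSpace ℝ (Fin d)))
    (E : Finset (EuclideanSpace ℝ (Fin d) × EuclideanSpace ℝ (Fin d))) : GeometricGraph d where
  verts := {a | a ∈ P ∨ a ∈ Prod.fst '' {e | e ∈ E} ∨ a ∈ Prod.snd '' {e | e ∈ E}}
  Adj a b := a ≠ b ∧ ((a, b) ∈ E ∨ (b, a) ∈ E)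
  adj_sub h := h.1
  edge_vert := by
    rintro a b ⟨-, h | h⟩
    · exact Or.inr (Or.inl ⟨_, h, rfl⟩)
    · exact Or.inr (Or.inr ⟨_, h, rfl⟩)
  symm := ⟨fun _ _ h => ⟨h.1.symm, h.2.symm⟩⟩

variable (P : Finset (EuclideanSpace ℝ (Fin d)))
  (E : Finset (EuclideanSpace ℝ (Fin d) × EuclideanSpace ℝ (Fin d)))

theorem graphOfPairs_verts_finite : (graphOfPairs P E).verts.Finite :=
  P.finite_toSet.union ((E.finite_toSet.image _).union (E.finite_toSet.image _))

theorem subset_graphOfPairs_verts : (P : Set _) ⊆ (graphOfPairs P E).verts :=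
  fun _ h => Or.inl h

theorem graphOfPairs_edgeSet_ncard_le : (graphOfPairs P E).edgeSet.ncard ≤ E.card := by
  classical
  have hsub : (graphOfPairs P E).edgeSet ⊆ (E.image fun a => s(a.1, a.2)) := by
    intro e
    induction e using Sym2.ind with
    | _ a b =>
      rintro ⟨-, h | h⟩
      · exact Finset.mem_image.2 ⟨(a, b), h, rfl⟩
      · exact Finset.mem_image.2 ⟨(b, a), h, Sym2.eq_swap⟩
  exact (Set.ncard_le_ncard hsub (Finset.finite_toSet _)).trans
    ((Set.ncard_coe_finset _).trans_le Finset.card_image_le)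

theorem geomDist_graphOfPairs_le {a b : EuclideanSpace ℝ (Fin d)}
    (h : (a, b) ∈ E ∨ (b, a) ∈ E) : geomDist (graphOfPairs P E) a b ≤ edist a b := by
  rcases eq_or_ne a b with rfl | hne
  · simp [geomDist_self]
  · exact geomDist_le_edist_of_adj _ ⟨hne, h⟩

end GraphOfPairs

/-! ### Cost of a detour, and the anisotropic Steiner grid. -/

section SteinerGrid

/-- A detour through a point at distance `r` from the middle half of a segment of length `D`
costs at most `4 * r ^ 2 / D`. -/
theorem dist_add_dist_le_of_near_segment {V : Type*} [NormedAddCommGroup V]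
    [InnerProductSpace ℝ V] {p q s : V} (hpq : p ≠ q) {t : ℝ} (ht : 1 / 4 ≤ t) (ht' : t ≤ 3 / 4) :
    dist p s + dist s q ≤
      dist p q + 4 * ‖s - (p + t • (q - p))‖ ^ 2 / dist p q := by
  have amgm : ∀ (v : V) (A : ℝ), 0 < A → ‖v‖ ≤ (‖v‖ ^ 2 + A ^ 2) / (2 * A) := fun v A hA => by
    rw [le_div_iff₀ (by positivity)]
    nlinarith [sq_nonneg (‖v‖ - A)]
  have hD : 0 < dist p q := dist_pos.2 hpq
  set e := q - p with he
  set w := s - (p + t • e) with hw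
  have hDe : dist p q = ‖e‖ := by rw [dist_comm, dist_eq_norm]
  have h1 : dist p s = ‖t • e + w‖ := by
    rw [dist_comm, dist_eq_norm, hw]; congr 1; abel
  have h2 : dist s q = ‖(1 - t) • e - w‖ := by
    rw [dist_comm, dist_eq_norm, hw, sub_smul, one_smul, he]; congr 1; abel
  have n1 : ‖t • e + w‖ ^ 2 = t ^ 2 * ‖e‖ ^ 2 + 2 * t * inner ℝ e w + ‖w‖ ^ 2 := by
    rw [norm_add_sq_real, norm_smul, real_inner_smul_left, mul_pow, Real.norm_eq_abs, sq_abs]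
    ring
  have n2 : ‖(1 - t) • e - w‖ ^ 2 =
      (1 - t) ^ 2 * ‖e‖ ^ 2 - 2 * (1 - t) * inner ℝ e w + ‖w‖ ^ 2 := by
    rw [norm_sub_sq_real, norm_smul, real_inner_smul_left, mul_pow, Real.norm_eq_abs, sq_abs]
    ring
  rw [hDe] at hD
  have ht0 : 0 < t := by linarith
  have ht1 : 0 < 1 - t := by linarith
  -- With these choices of `A` the two inner product terms cancel, leaving only the quadratic error.
  have k1 := amgm (t • e + w) (t * ‖e‖) (by positivity)
  have k2 := amgm ((1 - t) • e - w) ((1 - t) * ‖e‖) (by positivity)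
  rw [n1] at k1
  rw [n2] at k2
  rw [hDe, h1, h2]
  refine (add_le_add k1 k2).trans ?_
  have hsum : (t ^ 2 * ‖e‖ ^ 2 + 2 * t * inner ℝ e w + ‖w‖ ^ 2 + (t * ‖e‖) ^ 2) / (2 * (t * ‖e‖)) +
      ((1 - t) ^ 2 * ‖e‖ ^ 2 - 2 * (1 - t) * inner ℝ e w + ‖w‖ ^ 2 + ((1 - t) * ‖e‖) ^ 2) /
        (2 * ((1 - t) * ‖e‖)) = ‖e‖ + ‖w‖ ^ 2 / ‖e‖ * (1 / (2 * (t * (1 - t)))) := by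
    field_simp
    ring
  rw [hsum, mul_div_right_comm, mul_comm (4 / ‖e‖), div_eq_mul_one_div (‖w‖ ^ 2), mul_assoc]
  have hb : 1 / (2 * (t * (1 - t))) ≤ 4 := by
    rw [div_le_iff₀ (by positivity)]
    nlinarith
  have : 1 / ‖e‖ * (1 / (2 * (t * (1 - t)))) ≤ 4 / ‖e‖ := by
    rw [one_div_mul_eq_div]
    gcongr
  gcongr

/-- The middle half of a long enough interval contains a multiple of `h`. -/
theorem exists_int_mul_eq_of_le_abs {h b c : ℝ} (hh : 0 < h) (hc : 2 * h ≤ |c|) :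
    ∃ (a : ℤ) (t : ℝ), 1 / 4 ≤ t ∧ t ≤ 3 / 4 ∧ b + t * c = a * h := by
  rcases le_total 0 c with h0 | h0
  · rw [abs_of_nonneg h0] at hc
    have hc0 : 0 < c := by linarith
    -- The first multiple of `h` past the quarter point; the middle half has length at least `h`.
    have h1 := Int.le_ceil ((b + c / 4) / h)
    have h2 := Int.ceil_lt_add_one ((b + c / 4) / h)
    rw [div_le_iff₀ hh] at h1
    rw [div_add_one hh.ne', lt_div_iff₀ hh] at h2
    refine ⟨⌈(b + c / 4) / h⌉, (⌈(b + c / 4) / h⌉ * h - b) / c, ?_, ?_, ?_⟩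
    · rw [le_div_iff₀ hc0]; linarith
    · rw [div_le_iff₀ hc0]; linarith
    · rw [div_mul_cancel₀ _ hc0.ne']; ring
  · rw [abs_of_nonpos h0] at hc
    have hc0 : c < 0 := by linarith
    have h1 := Int.floor_le ((b + c / 4) / h)
    have h2 := Int.lt_floor_add_one ((b + c / 4) / h)
    rw [le_div_iff₀ hh] at h1
    rw [div_lt_iff₀ hh] at h2
    refine ⟨⌊(b + c / 4) / h⌋, (⌊(b + c / 4) / h⌋ * h - b) / c, ?_, ?_, ?_⟩
    · rw [le_div_iff_of_neg hc0]; linarith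
    · rw [div_le_iff_of_neg hc0]; linarith
    · rw [div_mul_cancel₀ _ hc0.ne]; ring

variable {d : ℕ}

/-- The points within `r` of `p` in each coordinate whose `l`-th coordinate is a multiple of
`σ l`. -/
noncomputable def boxGrid (σ : Fin d → ℝ) (r : ℝ) (p : EuclideanSpace ℝ (Fin d)) :
    Finset (EuclideanSpace ℝ (Fin d)) := by
  classical
  exact (Fintype.piFinset fun l => Finset.Icc ⌈(p l - r) / σ l⌉ ⌊(p l + r) / σ l⌋).image
    fun a => WithLp.toLp 2 fun l => a l * σ l

theorem mem_boxGrid {σ : Fin d → ℝ} (hσ : ∀ l, 0 < σ l) {r : ℝ} {p : EuclideanSpace ℝ (Fin d)}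
    (a : Fin d → ℤ) (ha : ∀ l, |a l * σ l - p l| ≤ r) :
    WithLp.toLp 2 (fun l => a l * σ l) ∈ boxGrid σ r p := by
  classical
  refine Finset.mem_image.2 ⟨a, Fintype.mem_piFinset.2 fun l => Finset.mem_Icc.2 ⟨?_, ?_⟩, rfl⟩
  · rw [Int.ceil_le, div_le_iff₀ (hσ l)]
    linarith [(abs_le.1 (ha l)).1]
  · rw [Int.le_floor, le_div_iff₀ (hσ l)]
    linarith [(abs_le.1 (ha l)).2]

theorem card_boxGrid_le {σ : Fin d → ℝ} (hσ : ∀ l, 0 < σ l) {r : ℝ} (hr : 0 ≤ r)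
    (p : EuclideanSpace ℝ (Fin d)) :
    ((boxGrid σ r p).card : ℝ) ≤ ∏ l, (2 * r / σ l + 1) := by
  classical
  have h1 : (boxGrid σ r p).card ≤
      ∏ l, (Finset.Icc ⌈(p l - r) / σ l⌉ ⌊(p l + r) / σ l⌋).card :=
    Finset.card_image_le.trans (Fintype.card_piFinset _).le
  refine (Nat.cast_le.2 h1).trans ?_
  rw [Nat.cast_prod]
  refine Finset.prod_le_prod (fun _ _ => Nat.cast_nonneg _) fun l _ => ?_
  have hnn : 0 ≤ 2 * r / σ l + 1 := by have := hσ l; positivity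
  rw [Int.card_Icc, ← Int.cast_natCast, Int.toNat_eq_max, Int.cast_max, Int.cast_zero]
  refine max_le ?_ hnn
  push_cast
  have h2 := Int.floor_le ((p l + r) / σ l)
  have h3 := Int.le_ceil ((p l - r) / σ l)
  have h4 : (p l + r) / σ l - (p l - r) / σ l = 2 * r / σ l := by ring
  linarith

/-- The spacings of the Steiner points at scale `ρ`: `ρ / (8 d)` in direction `j` and
`ρ √ε / (4 d)` in the other directions. -/
noncomputable def steinerSpacing (ε ρ : ℝ) (j l : Fin d) : ℝ :=
  if l = j then ρ / (8 * d) else ρ * Real.sqrt ε / (4 * d)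

theorem steinerSpacing_pos {ε ρ : ℝ} (hε : 0 < ε) (hρ : 0 < ρ) (j l : Fin d) :
    0 < steinerSpacing ε ρ j l := by
  have : 0 < d := j.pos
  unfold steinerSpacing
  split_ifs <;> positivity

/-- The Steiner points at scale `ρ` near `p`. -/
noncomputable def steinerPoints (ε ρ : ℝ) (p : EuclideanSpace ℝ (Fin d)) :
    Finset (EuclideanSpace ℝ (Fin d)) := by
  classical
  exact Finset.univ.biUnion fun j => boxGrid (steinerSpacing ε ρ j) (3 * ρ) p

/-- For each `j`, direction `j` contributes a factor free of `ε`; each of the other `d - 1`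
contributes `O(d / √ε)`. -/
theorem card_steinerPoints_le {ε ρ : ℝ} (hε : 0 < ε) (hε1 : ε ≤ 1) (hρ : 0 < ρ)
    (p : EuclideanSpace ℝ (Fin d)) :
    ((steinerPoints ε ρ p).card : ℝ) ≤
      d * ((48 * d + 1) * (25 * d / Real.sqrt ε) ^ (d - 1)) := by
  classical
  have h1 : (steinerPoints ε ρ p).card ≤
      ∑ j, (boxGrid (steinerSpacing ε ρ j) (3 * ρ) p).card := Finset.card_biUnion_le
  have h2 : ∀ j : Fin d, ((boxGrid (steinerSpacing ε ρ j) (3 * ρ) p).card : ℝ) ≤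
      (48 * d + 1) * (25 * d / Real.sqrt ε) ^ (d - 1) := fun j => by
    have hd : (1 : ℝ) ≤ d := by exact_mod_cast j.pos
    have hs : 0 < Real.sqrt ε := Real.sqrt_pos.2 hε
    have hs1 : Real.sqrt ε ≤ 1 := Real.sqrt_le_one.2 hε1
    refine (card_boxGrid_le (steinerSpacing_pos hε hρ j) (by positivity) p).trans ?_
    rw [← Finset.mul_prod_erase _ _ (Finset.mem_univ j)]
    have e1 : 2 * (3 * ρ) / steinerSpacing ε ρ j j + 1 = 48 * d + 1 := by
      rw [steinerSpacing, if_pos rfl]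
      field_simp
      ring
    rw [e1]
    refine mul_le_mul_of_nonneg_left ?_ (by positivity)
    have hcard : (Finset.univ.erase j).card = d - 1 := by simp
    rw [← hcard, ← Finset.prod_const]
    refine Finset.prod_le_prod (fun l _ => ?_) fun l hl => ?_
    · have := steinerSpacing_pos hε hρ j l
      positivity
    · rw [steinerSpacing, if_neg (Finset.ne_of_mem_erase hl)]
      have e2 : 2 * (3 * ρ) / (ρ * Real.sqrt ε / (4 * d)) = 24 * d / Real.sqrt ε := by
        field_simp
        ring
      have e3 : 1 ≤ d / Real.sqrt ε := by
        rw [le_div_iff₀ hs]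
        linarith
      rw [e2]
      have e4 : 25 * d / Real.sqrt ε = 24 * d / Real.sqrt ε + d / Real.sqrt ε := by ring
      linarith
  calc ((steinerPoints ε ρ p).card : ℝ)
      ≤ ∑ j, ((boxGrid (steinerSpacing ε ρ j) (3 * ρ) p).card : ℝ) := by exact_mod_cast h1
    _ ≤ ∑ _j : Fin d, (48 * d + 1) * (25 * d / Real.sqrt ε) ^ (d - 1) :=
      Finset.sum_le_sum fun j _ => h2 j
    _ = _ := by simp

theorem exists_norm_le_sum_abs_coord (x : EuclideanSpace ℝ (Fin d)) (hd : 0 < d) :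
    ∃ j, ‖x‖ ≤ d * |x j| := by
  have : Nonempty (Fin d) := ⟨⟨0, hd⟩⟩
  obtain ⟨j, -, hj⟩ := Finset.univ.exists_max_image (fun j => |x j|) Finset.univ_nonempty
  refine ⟨j, abs_le_of_sq_le_sq ?_ (by positivity) |> (le_abs_self _).trans⟩
  have hd1 : (1 : ℝ) ≤ d := by exact_mod_cast hd
  rw [EuclideanSpace.real_norm_sq_eq]
  calc ∑ i, x i ^ 2 ≤ ∑ _i : Fin d, |x j| ^ 2 := Finset.sum_le_sum fun i _ => by
        rw [← sq_abs]
        exact pow_le_pow_left₀ (abs_nonneg _) (hj i (Finset.mem_univ i)) 2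
    _ = d * |x j| ^ 2 := by simp
    _ ≤ (d * |x j|) ^ 2 := by
      rw [mul_pow]
      refine mul_le_mul_of_nonneg_right ?_ (by positivity)
      nlinarith

/-- Two points at distance about `ρ` have a common Steiner point, through which the detour costs
at most `ε / 4 * ρ`. -/
theorem exists_common_steinerPoint {ε ρ : ℝ} (hd : 0 < d) (hε : 0 < ε) (hε1 : ε ≤ 1) (hρ : 0 < ρ)
    {p q : EuclideanSpace ℝ (Fin d)} (h1 : ρ / 4 ≤ dist p q) (h2 : dist p q ≤ 2 * ρ) :
    ∃ s ∈ steinerPoints ε ρ p, s ∈ steinerPoints ε ρ q ∧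
      dist p s + dist s q ≤ dist p q + ε / 4 * ρ := by
  classical
  have hd1 : (1 : ℝ) ≤ d := by exact_mod_cast hd
  have hs : 0 < Real.sqrt ε := Real.sqrt_pos.2 hε
  have hs1 : Real.sqrt ε ≤ 1 := Real.sqrt_le_one.2 hε1
  have hpq0 : 0 < dist p q := by linarith
  have hnorm : dist p q = ‖q - p‖ := by rw [dist_comm, dist_eq_norm]
  obtain ⟨j, hj⟩ := exists_norm_le_sum_abs_coord (q - p) hd
  rw [← hnorm] at hj
  have hh : 0 < ρ / (8 * d) := by positivity
  have hc : 2 * (ρ / (8 * d)) ≤ |(q - p) j| := by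
    rw [← mul_div_assoc, div_le_iff₀ (by positivity)]
    linarith
  obtain ⟨a, t, ht, ht', hat⟩ := exists_int_mul_eq_of_le_abs (b := p j) hh hc
  set z := p + t • (q - p) with hz
  set σ := steinerSpacing ε ρ j with hσ
  have hσpos : ∀ l, 0 < σ l := steinerSpacing_pos hε hρ j
  set g := ρ * Real.sqrt ε / (4 * d) with hg
  have hg0 : 0 < g := by positivity
  have hgρ : g ≤ ρ := by
    rw [hg, div_le_iff₀ (by positivity)]
    nlinarith
  -- The segment meets a grid hyperplane at `z`, so coordinate `j` is exact and only the others are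
  -- rounded.
  let b : Fin d → ℤ := fun l => if l = j then a else round (z l / g)
  have hb : ∀ l, |b l * σ l - z l| ≤ g / 2 := by
    intro l
    rcases eq_or_ne l j with rfl | hl
    · have e1 : b l = a := if_pos rfl
      have e2 : σ l = ρ / (8 * d) := if_pos rfl
      have e3 : z l = p l + t * (q - p) l := by simp [hz]
      rw [e1, e2, e3, hat, sub_self, abs_zero]
      positivity
    · have e1 : b l = round (z l / g) := if_neg hl
      have e2 : σ l = g := if_neg hl
      rw [e1, e2, abs_sub_comm]
      have e3 : z l - round (z l / g) * g = (z l / g - round (z l / g)) * g := by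
        field_simp
      rw [e3, abs_mul, abs_of_pos hg0]
      have := mul_le_mul_of_nonneg_right (abs_sub_round (z l / g)) hg0.le
      linarith
  set s : EuclideanSpace ℝ (Fin d) := WithLp.toLp 2 fun l => b l * σ l with hsdef
  -- The grid is anchored at the origin, not at `x`, so `p` and `q` can share `s`.
  have hmem : ∀ x : EuclideanSpace ℝ (Fin d), ‖z - x‖ ≤ 2 * ρ → s ∈ steinerPoints ε ρ x := by
    intro x hx
    refine Finset.mem_biUnion.2 ⟨j, Finset.mem_univ j, mem_boxGrid hσpos b fun l => ?_⟩
    have hl : |z l - x l| ≤ 2 * ρ := by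
      have := PiLp.norm_apply_le (z - x) l
      rw [PiLp.sub_apply, Real.norm_eq_abs] at this
      exact this.trans hx
    have := abs_sub_le (b l * σ l) (z l) (x l)
    linarith [hb l]
  have hzp : z - p = t • (q - p) := by rw [hz]; abel
  have hzq : z - q = (t - 1) • (q - p) := by rw [hz, sub_smul, one_smul]; abel
  refine ⟨s, hmem p ?_, hmem q ?_, ?_⟩
  · rw [hzp, norm_smul, ← hnorm, Real.norm_eq_abs, abs_of_nonneg (by linarith)]
    nlinarith
  · rw [hzq, norm_smul, ← hnorm, Real.norm_eq_abs, abs_of_nonpos (by linarith)]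
    nlinarith
  · refine (dist_add_dist_le_of_near_segment (dist_pos.1 hpq0) ht ht').trans ?_
    have hsz : ‖s - z‖ ^ 2 ≤ d * (g / 2) ^ 2 := by
      rw [EuclideanSpace.real_norm_sq_eq]
      calc ∑ l, (s - z) l ^ 2 ≤ ∑ _l : Fin d, (g / 2) ^ 2 := Finset.sum_le_sum fun l _ => by
            rw [← sq_abs]
            exact pow_le_pow_left₀ (abs_nonneg _) (hb l) 2
        _ = d * (g / 2) ^ 2 := by simp
    have hgsq : d * (g / 2) ^ 2 = ρ ^ 2 * ε / (64 * d) := by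
      have : g ^ 2 = ρ ^ 2 * ε / (16 * d ^ 2) := by
        rw [hg, div_pow, mul_pow, Real.sq_sqrt hε.le]; ring
      rw [div_pow, this]
      field_simp
      ring
    have hle : ρ ^ 2 * ε / (64 * d) ≤ ρ ^ 2 * ε / 64 := by
      gcongr
      linarith
    rw [add_le_add_iff_left, div_le_iff₀ hpq0]
    have : ε / 4 * ρ * (ρ / 4) ≤ ε / 4 * ρ * dist p q := by gcongr
    nlinarith

end SteinerGrid

/-! ### Assembly of the spanner and choice of constants. -/

section Spanner

variable {d : ℕ}

theorem exists_steinerSpanner (hd : 0 < d) {ε : ℝ} (hε : 0 < ε) (hε2 : ε ≤ 1 / 2) {k : ℕ}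
    (hk : 20 ≤ 2 ^ k * ε) (P : Finset (EuclideanSpace ℝ (Fin d))) :
    ∃ H : GeometricGraph d, IsSteinerSpanner (1 + ε) P H ∧
      (H.edgeSet.ncard : ℝ) ≤ P.card * (k + 9) *
        (d * ((48 * d + 1) * (25 * d / Real.sqrt ε) ^ (d - 1))) := by
  classical
  obtain ⟨R, hR, hdiam⟩ : ∃ R : ℝ, 0 < R ∧ ∀ x ∈ P, ∀ y ∈ P, dist x y ≤ R / 8 := by
    refine ⟨8 * (Metric.diam (P : Set (EuclideanSpace ℝ (Fin d))) + 1), ?_, fun x hx y hy => ?_⟩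
    · have := Metric.diam_nonneg (s := (P : Set (EuclideanSpace ℝ (Fin d))))
      positivity
    · have := Metric.dist_le_diam_of_mem P.finite_toSet.isBounded hx hy
      linarith
  obtain ⟨N, hmono, hNP, hsep, hcov⟩ := exists_nested_nets P hR
  obtain ⟨A, hAcard, hA⟩ := exists_active_pairs_bound P hR N hmono hNP hsep hcov k
  set E : Finset (EuclideanSpace ℝ (Fin d) × EuclideanSpace ℝ (Fin d)) :=
    A.biUnion fun a => (steinerPoints ε (R / 2 ^ (a.2 + 3)) a.1).image fun s => (a.1, s) with hE
  have hmemE : ∀ p m s, (p, m) ∈ A → s ∈ steinerPoints ε (R / 2 ^ (m + 3)) p → (p, s) ∈ E :=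
    fun p m s hp hs => Finset.mem_biUnion.2 ⟨(p, m), hp, Finset.mem_image.2 ⟨s, hs, rfl⟩⟩
  refine ⟨graphOfPairs P E, ⟨graphOfPairs_verts_finite P E, subset_graphOfPairs_verts P E, ?_⟩, ?_⟩
  -- Induction on distance, as a violating pair at least distance.
  · by_contra! hbad
    obtain ⟨x₀, hx₀, y₀, hy₀, hxy₀⟩ := hbad
    set B := (P ×ˢ P).filter fun a =>
      ENNReal.ofReal (1 + ε) * edist a.1 a.2 < geomDist (graphOfPairs P E) a.1 a.2 with hB
    obtain ⟨⟨x, y⟩, hxyB, hmin⟩ := B.exists_min_image (fun a => dist a.1 a.2)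
      ⟨(x₀, y₀), Finset.mem_filter.2 ⟨Finset.mk_mem_product hx₀ hy₀, hxy₀⟩⟩
    obtain ⟨hxy, hlt⟩ := Finset.mem_filter.1 hxyB
    obtain ⟨hx, hy⟩ := Finset.mem_product.1 hxy
    simp only at hx hy hlt hmin
    have hsmall : ∀ u ∈ P, ∀ v ∈ P, dist u v < dist x y →
        geomDist (graphOfPairs P E) u v ≤ ENNReal.ofReal ((1 + ε) * dist u v) := by
      intro u hu v hv huv
      by_contra! h
      rw [ENNReal.ofReal_mul (by positivity), ← edist_dist] at h
      have := hmin (u, v) (Finset.mem_filter.2 ⟨Finset.mk_mem_product hu hv, h⟩)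
      exact absurd huv (not_lt.2 this)
    have hne : x ≠ y := by
      rintro rfl
      simp [geomDist_self] at hlt
    have hδ : 0 < dist x y := dist_pos.2 hne
    obtain ⟨m, hm1, hm2⟩ := exists_nat_pow_near_of_lt_one (x := dist x y / (R / 8))
      (y := (1 / 2 : ℝ)) (by positivity) ((div_le_one (by positivity)).2 (hdiam x hx y hy))
      (by norm_num) (by norm_num)
    set ρ := R / 2 ^ (m + 3) with hρ
    have hρ0 : 0 < ρ := by positivity
    have hρ' : ρ = (1 / 2) ^ m * (R / 8) := by
      rw [hρ, pow_add, one_div_pow]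
      field_simp
      norm_num
    rw [lt_div_iff₀ (by positivity), pow_succ, mul_right_comm, ← hρ'] at hm1
    rw [div_le_iff₀ (by positivity), ← hρ'] at hm2
    have hfine : R / 2 ^ (m + 3 + k) ≤ ε / 20 * ρ := by
      rw [pow_add, ← div_div, ← hρ, div_le_iff₀ (by positivity)]
      have := mul_le_mul_of_nonneg_left hk hρ0.le
      linarith
    obtain ⟨p, hp, hxp⟩ := hcov (m + 3 + k) x hx
    obtain ⟨q, hq, hyq⟩ := hcov (m + 3 + k) y hy
    have hxp' := hxp.trans hfine
    have hyq' := hyq.trans hfine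
    have hερ : ε * ρ ≤ 1 / 2 * ρ := by gcongr
    have hpP := hNP _ hp
    have hqP := hNP _ hq
    have hpq1 : dist p q ≤ dist x y + ε / 10 * ρ := by
      have h1 := dist_triangle4 p x y q
      rw [dist_comm p x] at h1
      linarith
    have hpq2 : dist x y ≤ dist p q + ε / 10 * ρ := by
      have h1 := dist_triangle4 x p q y
      rw [dist_comm q y] at h1
      linarith
    obtain ⟨s, hsp, hsq, hs⟩ := exists_common_steinerPoint (p := p) (q := q) hd hε (by linarith)
      hρ0 (by linarith) (by linarith)
    have hpA : (p, m) ∈ A := hA m p hp q hqP (by linarith) (by linarith)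
    have hqA : (q, m) ∈ A := by
      refine hA m q hq p hpP ?_ ?_ <;> rw [dist_comm] <;> linarith
    have g1 := hsmall x hx p hpP (by linarith)
    have g2 := hsmall q hqP y hy (by rw [dist_comm]; linarith)
    have g3 := geomDist_graphOfPairs_le P E (Or.inl (hmemE p m s hpA hsp))
    have g4 := geomDist_graphOfPairs_le P E (Or.inr (hmemE q m s hqA hsq))
    rw [edist_dist] at g3 g4
    refine absurd hlt (not_lt.2 ?_)
    calc geomDist (graphOfPairs P E) x y
        ≤ geomDist (graphOfPairs P E) x p + (geomDist (graphOfPairs P E) p s +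
            (geomDist (graphOfPairs P E) s q + geomDist (graphOfPairs P E) q y)) :=
          (geomDist_triangle _ x p y).trans <| add_le_add_right
            ((geomDist_triangle _ p s y).trans <| add_le_add_right
              (geomDist_triangle _ s q y) _) _
      _ ≤ ENNReal.ofReal ((1 + ε) * dist x p) + (ENNReal.ofReal (dist p s) +
            (ENNReal.ofReal (dist s q) + ENNReal.ofReal ((1 + ε) * dist q y))) := by
          gcongr
      _ = ENNReal.ofReal ((1 + ε) * dist x p + (dist p s + (dist s q + (1 + ε) * dist q y))) := by
          rw [ENNReal.ofReal_add, ENNReal.ofReal_add, ENNReal.ofReal_add] <;> positivity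
      _ ≤ ENNReal.ofReal ((1 + ε) * dist x y) := by
          -- Excess in units of `ερ`: `3/20` for the gaps, `1/10` for moving to `p`, `q`, and `1/4`
          -- for the detour. The total is `1/2`, and `ρ/2 < dist x y`.
          refine ENNReal.ofReal_le_ofReal ?_
          rw [dist_comm q y]
          have e1 : (1 + ε) * dist x p ≤ 3 / 2 * (ε / 20 * ρ) := by
            gcongr
            linarith
          have e2 : (1 + ε) * dist y q ≤ 3 / 2 * (ε / 20 * ρ) := by
            gcongr
            linarith
          have e3 : ε * (ρ * (1 / 2)) ≤ ε * dist x y := by gcongr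
          linarith
      _ = ENNReal.ofReal (1 + ε) * edist x y := by
          rw [ENNReal.ofReal_mul (by positivity), ← edist_dist]
  · set M : ℝ := d * ((48 * d + 1) * (25 * d / Real.sqrt ε) ^ (d - 1)) with hM
    have hM0 : 0 ≤ M := by positivity
    have h1 : E.card ≤ ∑ a ∈ A, (steinerPoints ε (R / 2 ^ (a.2 + 3)) a.1).card :=
      Finset.card_biUnion_le.trans (Finset.sum_le_sum fun _ _ => Finset.card_image_le)
    calc ((graphOfPairs P E).edgeSet.ncard : ℝ) ≤ E.card :=
          Nat.cast_le.2 (graphOfPairs_edgeSet_ncard_le P E)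
      _ ≤ ∑ a ∈ A, ((steinerPoints ε (R / 2 ^ (a.2 + 3)) a.1).card : ℝ) := by exact_mod_cast h1
      _ ≤ ∑ _a ∈ A, M := Finset.sum_le_sum fun a _ =>
          card_steinerPoints_le hε (by linarith) (by positivity) a.1
      _ = A.card * M := by simp
      _ ≤ P.card * (k + 9) * M := by
          gcongr
          exact_mod_cast hAcard

/-- Steiner spanners with `O(n ε^{-(d-1)/2} log (1/ε))` edges. -/
theorem exists_steinerSpanner_log (hd : 0 < d) :
    ∃ C : ℝ, 0 < C ∧ ∀ ε : ℝ, 0 < ε → ε ≤ 1 / 2 →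
      ∀ P : Finset (EuclideanSpace ℝ (Fin d)),
        ∃ H : GeometricGraph d, IsSteinerSpanner (1 + ε) P H ∧
          (H.edgeSet.ncard : ℝ) ≤
            C * ((P.card : ℝ) / ε ^ (((d : ℝ) - 1) / 2) * Real.log (1 / ε)) := by
  have hd0 : (0 : ℝ) < d := by exact_mod_cast hd
  refine ⟨25 * (d * ((48 * d + 1) * (25 * d) ^ (d - 1))), by positivity, fun ε hε hε2 P => ?_⟩
  set ℓ := Real.log (1 / ε) with hℓ
  have hlog2 := Real.log_two_gt_d9
  have hℓ2 : Real.log 2 ≤ ℓ := by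
    refine Real.log_le_log (by norm_num) ?_
    rw [le_div_iff₀ hε]
    linarith
  -- `2 ^ (2ℓ) ≥ 1/ε` because `log 2 > 1/2`, and `2 ^ 5 ≥ 20`.
  have hk : 20 ≤ 2 ^ (⌈2 * ℓ⌉₊ + 5) * ε := by
    have h1 : 1 / ε ≤ 2 ^ ⌈2 * ℓ⌉₊ := by
      rw [← Real.log_le_log_iff (by positivity) (by positivity), Real.log_pow]
      have := mul_le_mul (Nat.le_ceil (2 * ℓ)) hlog2.le (by norm_num) (Nat.cast_nonneg _)
      linarith
    rw [div_le_iff₀ hε] at h1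
    rw [pow_add]
    linarith
  obtain ⟨H, hH, hcard⟩ := exists_steinerSpanner hd hε hε2 hk P
  refine ⟨H, hH, hcard.trans ?_⟩
  have hkℓ : ((⌈2 * ℓ⌉₊ + 5 : ℕ) : ℝ) + 9 ≤ 25 * ℓ := by
    have := Nat.ceil_lt_add_one (a := 2 * ℓ) (by linarith)
    push_cast
    linarith
  have hpow : ε ^ (((d : ℝ) - 1) / 2) = Real.sqrt ε ^ (d - 1) := by
    rw [Real.sqrt_eq_rpow, ← Real.rpow_natCast, ← Real.rpow_mul hε.le, Nat.cast_sub hd,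
      Nat.cast_one]
    congr 1
    ring
  rw [hpow, div_pow]
  calc _ ≤ (P.card : ℝ) * (25 * ℓ) *
        (d * ((48 * d + 1) * ((25 * d) ^ (d - 1) / Real.sqrt ε ^ (d - 1)))) := by gcongr
    _ = _ := by ring

theorem exists_steinerSpanner_log_sq (hd : 0 < d) :
    ∃ C : ℝ, 0 < C ∧ ∀ ε : ℝ, 0 < ε → ε ≤ 1 / 2 →
      ∀ P : Finset (EuclideanSpace ℝ (Fin d)),
        ∃ H : GeometricGraph d, IsSteinerSpanner (1 + ε) P H ∧
          (H.edgeSet.ncard : ℝ) ≤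
            C * ((P.card : ℝ) / ε ^ (((d : ℝ) - 1) / 2) * (Real.log (1 / ε)) ^ 2) := by
  obtain ⟨C, hC, h⟩ := exists_steinerSpanner_log hd
  refine ⟨2 * C, by positivity, fun ε hε hε2 P => ?_⟩
  obtain ⟨H, hH, hcard⟩ := h ε hε hε2 P
  refine ⟨H, hH, hcard.trans ?_⟩
  have hℓ : 1 / 2 ≤ Real.log (1 / ε) := by
    have : Real.log 2 ≤ Real.log (1 / ε) := by
      refine Real.log_le_log (by norm_num) ?_
      rw [le_div_iff₀ hε]
      linarith
    linarith [Real.log_two_gt_d9]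
  have hsq : Real.log (1 / ε) ≤ 2 * Real.log (1 / ε) ^ 2 := by nlinarith
  calc _ ≤ C * ((P.card : ℝ) / ε ^ (((d : ℝ) - 1) / 2) * (2 * Real.log (1 / ε) ^ 2)) := by gcongr
    _ = _ := by ring

end Spanner

theorem theorem3 :
    (∃ C : ℝ, 0 < C ∧
      ∀ ε : ℝ, 0 < ε → ε ≤ 1 / 2 →
        ∀ P : Finset (EuclideanSpace ℝ (Fin 2)),
          ∃ H : GeometricGraph 2, IsSteinerSpanner (1 + ε) P H ∧
            (H.edgeSet.ncard : ℝ) ≤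
              C * ((P.card : ℝ) / Real.sqrt ε * (Real.log (1 / ε)) ^ 2)) ∧
    (∀ d : ℕ, 2 ≤ d →
      ∃ C : ℝ, 0 < C ∧
        ∀ ε : ℝ, 0 < ε → ε ≤ 1 / 2 →
          ∀ P : Finset (EuclideanSpace ℝ (Fin d)),
            ∃ H : GeometricGraph d, IsSteinerSpanner (1 + ε) P H ∧
              (H.edgeSet.ncard : ℝ) ≤
                C * ((P.card : ℝ) / ε ^ (((d : ℝ) - 1) / 2) * (Real.log (1 / ε)) ^ 2)) := by
  refine ⟨?_, fun d hd => exists_steinerSpanner_log_sq (by omega)⟩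
  have h := exists_steinerSpanner_log_sq (d := 2) (by norm_num)
  have e : (((2 : ℕ) : ℝ) - 1) / 2 = 1 / 2 := by norm_num
  simp only [e, ← Real.sqrt_eq_rpow] at h
  exact h
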